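/- **Lemma (Gohberg's lemma).** Let $(M,g)$ be a closed (compact, without boundary) smooth Riemannian manifold of dimension $n$, with $L^2(M)$ taken with respect to the Riemannian volume. Let $A\colon C^\infty(M)\to C^\infty(M)$ be a classical pseudodifferential operator of order $0$; that is, $A$ is linear and, for every coordinate chart $\kappa\colon U\to\kappa(U)\subset\mathbb{R}^n$ of $M$ and all $\varphi,\psi\in C_c^\infty(\kappa(U))$, there is a classical symbol $a\in S^0(\mathbb{R}^n\times\mathbb{R}^n)$, $a\sim\sum_{j\ge 0}a_{-j}$ with $a_{-j}$ homogeneous of degree $-j$ in $\xi$, such that for all Schwartz functions $u$ $$\varphi\,(\kappa^{-1})^*A\,\kappa^*(\psi u)(y)=\frac{1}{(2\pi)^n}\int_{\mathbb{R}^n} e^{iy\cdot\xi}a(y,\xi)\widehat u(\xi)\,d\xi ,\qquad \widehat u(\xi)=\int_{\mathbb{R}^n} e^{-iz\cdot\xi}u(z)\,dz .$$ Let $\sigma_0(A)\colon T^*M\setminus 0\to\mathbb{C}$ be the principal symbol of $A$: if $\varphi=\psi=1$ near $\kappa(x)$, then $\sigma_0(A)(x,\xi)=a_0(\kappa(x),(\kappa^{-1})^*\xi)$.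 Then $$\|\sigma_0(A)\|_\infty:=\sup_{x\in M,\;\xi\in T_x^*M\setminus\{0\}}|\sigma_0(A)(x,\xi)|\;\le\;\|A\|_{\mathrm{ess}},$$ where $$\|A\|_{\mathrm{ess}}:=\inf\{\|A-K\|_{2}\;:\;K\colon L^2(M)\to L^2(M)\text{ compact}\},\qquad \|A-K\|_{2}:=\sup\{\|Au-Ku\|_{L^2(M)}\;:\;u\in C^\infty(M),\ \|u\|_{L^2(M)}\le 1\}.$$ -/

import Mathlib

open MeasureTheory Set Filter Topology
open scoped Manifold ContDiff SchwartzMap Distributions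

noncomputable section

namespace Gohberg

/-- The model space `ℝⁿ` with its Euclidean norm. -/
abbrev Eucl (n : ℕ) : Type := EuclideanSpace ℝ (Fin n)

/-! ### Symbols and their quantization on `ℝⁿ` -/

section Symbols

variable {n : ℕ}

/-- The bounds `|∂_ξ^α ∂_x^β a(x, ξ)| ≤ C_{αβ} (1 + |ξ|)^{m - |α|}` for all multi-indices `α`, `β`,
uniformly over all `x ∈ ℝⁿ` and all `ξ ∈ S`. -/
def SymbolBounds (m : ℝ) (S : Set (Eucl n)) (a : Eucl n → Eucl n → ℂ) : Prop :=
  ∀ j k : ℕ, ∃ C : ℝ, ∀ x : Eucl n, ∀ ξ ∈ S,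
    ‖iteratedFDeriv ℝ j (fun ζ => iteratedFDeriv ℝ k (fun z => a z ζ) x) ξ‖
      ≤ C * (1 + ‖ξ‖) ^ (m - j)

/-- The symbol class `S^m(ℝⁿ × ℝⁿ)`. -/
def IsSymbol (m : ℝ) (a : Eucl n → Eucl n → ℂ) : Prop :=
  ContDiff ℝ ∞ (fun p : Eucl n × Eucl n => a p.1 p.2) ∧ SymbolBounds m univ a

/-- `a ∈ S^m` is a classical (polyhomogeneous) symbol with asymptotic expansion
`a ∼ b₀ + b₁ + b₂ + ⋯`: each `b_j` is smooth on `ℝⁿ × (ℝⁿ ∖ 0)` and positively homogeneous of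
degree `m - j` in `ξ`, and `a - (b₀ + ⋯ + b_{N-1})` satisfies the estimates of `S^{m-N}`
on `|ξ| ≥ 1` (only large `ξ` matter here, since `a ∈ S^m` controls the region `|ξ| ≤ 1`). -/
structure HasClassicalExpansion (m : ℝ) (a : Eucl n → Eucl n → ℂ)
    (b : ℕ → Eucl n → Eucl n → ℂ) : Prop where
  isSymbol : IsSymbol m a
  smooth : ∀ j, ContDiffOn ℝ ∞ (fun p : Eucl n × Eucl n => b j p.1 p.2) {p | p.2 ≠ 0}
  homogeneous : ∀ j x ξ, ξ ≠ 0 → ∀ t : ℝ, 0 < t → b j x (t • ξ) = ((t ^ (m - j) : ℝ) : ℂ) * b j x ξ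
  remainder : ∀ N : ℕ, SymbolBounds (m - N) {ξ | 1 ≤ ‖ξ‖}
    (fun x ξ => a x ξ - ∑ j ∈ Finset.range N, b j x ξ)

/-- The quantization
`Op(a) u (x) = (2π)⁻ⁿ ∫ e^{i x·ξ} a(x, ξ) û(ξ) dξ`, `û(ξ) = ∫ e^{-i y·ξ} u(y) dy`. -/
def quantize (a : Eucl n → Eucl n → ℂ) (u : 𝓢(Eucl n, ℂ)) (x : Eucl n) : ℂ :=
  ((2 * Real.pi : ℝ) : ℂ)⁻¹ ^ n *
    ∫ ξ : Eucl n, Complex.exp (Complex.I * (inner ℝ x ξ : ℝ)) * a x ξ *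
      ∫ y : Eucl n, Complex.exp (-(Complex.I * (inner ℝ y ξ : ℝ))) * u y

end Symbols

/-! ### Smooth functions on a manifold and their coordinate representations -/

/-- The coordinate domain `κ(U) ⊆ ℝⁿ` of a chart `κ : U → ℝⁿ`, as a bundled open set. -/
def chartDomain {n : ℕ} {M : Type*} [TopologicalSpace M]
    (κ : OpenPartialHomeomorph M (Eucl n)) :
    TopologicalSpace.Opens (Eucl n) :=
  ⟨κ.target, κ.open_target⟩

theorem exists_cutoff {n : ℕ} {M : Type*} [TopologicalSpace M]
    (κ : OpenPartialHomeomorph M (Eucl n)) {y₀ : Eucl n} (hy : y₀ ∈ κ.target) :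
    ∃ φ : 𝓓(chartDomain κ, ℂ), ∀ᶠ y in 𝓝 y₀, φ y = 1 := by
  obtain ⟨r, hr, hrt⟩ := Metric.nhds_basis_closedBall.mem_iff.1 (κ.open_target.mem_nhds hy)
  let f : ContDiffBump y₀ := ⟨r / 2, r, by positivity, by linarith⟩
  have hts : tsupport (fun y => ((f y : ℝ) : ℂ)) ⊆ Metric.closedBall y₀ r := by
    refine (closure_mono fun y hy => ?_).trans f.tsupport_eq.subset
    simpa using hy
  refine ⟨⟨fun y => ((f y : ℝ) : ℂ), Complex.ofRealCLM.contDiff.comp f.contDiff, ?_,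
    hts.trans hrt⟩, ?_⟩
  · exact (isCompact_closedBall y₀ r).of_isClosed_subset (isClosed_tsupport _) hts
  · filter_upwards [f.eventuallyEq_one] with y hy
    change ((f y : ℝ) : ℂ) = 1
    rw [hy]; simp

section Manifold

variable (n : ℕ) (M : Type*) [TopologicalSpace M] [ChartedSpace (Eucl n) M]

/-- The complex vector space `C^∞(M)` of smooth complex-valued functions. -/
def SmoothFun : Submodule ℂ (M → ℂ) where
  carrier := {f | ContMDiff (𝓡 n) 𝓘(ℝ, ℂ) ∞ f}
  add_mem' hf hg := hf.add hg
  zero_mem' := contMDiff_const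
  smul_mem' c _ hf := by
    have h : ContDiff ℝ ∞ (fun z : ℂ => c * z) := contDiff_const.mul contDiff_id
    exact h.contMDiff.comp hf

variable {n M}

open Classical in
/-- The function `κ^*(ψ u)` on `M`, extended by zero outside of the chart. -/
def pullbackFun (κ : OpenPartialHomeomorph M (Eucl n)) (ψ : 𝓓(chartDomain κ, ℂ))
    (u : 𝓢(Eucl n, ℂ)) (x : M) : ℂ :=
  if x ∈ κ.source then ψ (κ x) * u (κ x) else 0

theorem contMDiff_pullbackFun [T2Space M] [IsManifold (𝓡 n) ∞ M]
    {κ : OpenPartialHomeomorph M (Eucl n)} (hκ : κ ∈ IsManifold.maximalAtlas (𝓡 n) ∞ M)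
    (ψ : 𝓓(chartDomain κ, ℂ)) (u : 𝓢(Eucl n, ℂ)) :
    ContMDiff (𝓡 n) 𝓘(ℝ, ℂ) ∞ (pullbackFun κ ψ u) := by
  intro x
  by_cases hx : x ∈ κ.source
  · have h1 : ContMDiffAt (𝓡 n) 𝓘(ℝ, ℂ) ∞ ((fun y => ψ y * u y) ∘ κ) x := by
      apply ContMDiffAt.comp x _ (contMDiffAt_of_mem_maximalAtlas hκ hx)
      exact ((ψ.contDiff.mul (u.smooth ⊤)).contMDiff) _
    refine h1.congr_of_eventuallyEq ?_
    filter_upwards [κ.open_source.mem_nhds hx] with z hz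
    simp [pullbackFun, hz]
  · have hK : IsCompact (κ.symm '' tsupport ψ) :=
      ψ.hasCompactSupport.isCompact.image_of_continuousOn
        (κ.continuousOn_symm.mono ψ.tsupport_subset)
    have hxK : x ∉ κ.symm '' tsupport ψ := by
      rintro ⟨y, hy, rfl⟩
      exact hx (κ.map_target (ψ.tsupport_subset hy))
    refine (contMDiffAt_const (c := (0 : ℂ))).congr_of_eventuallyEq ?_
    filter_upwards [hK.isClosed.isOpen_compl.mem_nhds hxK] with z hz
    by_cases hzs : z ∈ κ.source
    · have : ψ (κ z) = 0 := by
        by_contra h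
        exact hz ⟨κ z, subset_tsupport _ h, κ.left_inv hzs⟩
      simp [pullbackFun, this]
    · simp [pullbackFun, hzs]

variable [T2Space M] [IsManifold (𝓡 n) ∞ M]

/-- `κ^*(ψ u)` as an element of `C^∞(M)`. -/
def pullback {κ : OpenPartialHomeomorph M (Eucl n)}
    (hκ : κ ∈ IsManifold.maximalAtlas (𝓡 n) ∞ M) (ψ : 𝓓(chartDomain κ, ℂ))
    (u : 𝓢(Eucl n, ℂ)) : SmoothFun n M :=
  ⟨pullbackFun κ ψ u, contMDiff_pullbackFun hκ ψ u⟩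

/-- The localized operator `u ↦ φ (κ⁻¹)^* A κ^*(ψ u)` on `ℝⁿ` is `Op(a)`. (Off `κ(U)` the value
`κ.symm y` is irrelevant, as `φ y = 0` there.) -/
def IsLocalSymbol (A : SmoothFun n M →ₗ[ℂ] SmoothFun n M)
    {κ : OpenPartialHomeomorph M (Eucl n)} (hκ : κ ∈ IsManifold.maximalAtlas (𝓡 n) ∞ M)
    (φ ψ : 𝓓(chartDomain κ, ℂ)) (a : Eucl n → Eucl n → ℂ) : Prop :=
  ∀ (u : 𝓢(Eucl n, ℂ)) (y : Eucl n),
    φ y * (A (pullback hκ ψ u) : M → ℂ) (κ.symm y) = quantize a u y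

/-! ### Classical pseudodifferential operators and their principal symbols -/

/-- `A ∈ Ψ^m_cl(M)`: for every coordinate patch `κ` of `M` (not necessarily connected, so that two
distinct points lie in a common patch and the off-diagonal part of the kernel is covered as well)
and all `φ, ψ ∈ C_c^∞(κ(U))`, the operator `φ (κ⁻¹)^* A κ^* ψ` is the quantization of a classical
symbol of order `m`. On a compact manifold this forces `A` to be continuous on `C^∞(M)`. -/
def IsClassicalPDO (m : ℝ) (A : SmoothFun n M →ₗ[ℂ] SmoothFun n M) : Prop :=
  ∀ (κ : OpenPartialHomeomorph M (Eucl n)) (hκ : κ ∈ IsManifold.maximalAtlas (𝓡 n) ∞ M)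
    (φ ψ : 𝓓(chartDomain κ, ℂ)),
    ∃ a b, HasClassicalExpansion m a b ∧ IsLocalSymbol A hκ φ ψ a

/-- The coordinates `η = (κ⁻¹)^* ξ ∈ ℝⁿ` of a covector `ξ ∈ T_x^*M`, that is,
`ξ = ∑ η_i dκ_i`. -/
def coordCovector (κ : OpenPartialHomeomorph M (Eucl n)) (x : M)
    (ξ : TangentSpace (𝓡 n) x →L[ℝ] ℝ) : Eucl n :=
  (InnerProductSpace.toDual ℝ (Eucl n)).symm
    (ξ.comp (mfderiv (𝓡 n) (𝓡 n) κ x).inverse)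

/-- `s` is the value at `(x, ξ)` of the principal symbol of `A ∈ Ψ^m_cl(M)`: it is the value of the
leading homogeneous term of the symbol of `A` in local coordinates near `x`. By the invariance of
the principal symbol it does not depend on the coordinates or on the cutoffs. -/
def IsPrincipalSymbolAt (m : ℝ) (A : SmoothFun n M →ₗ[ℂ] SmoothFun n M) (x : M)
    (ξ : TangentSpace (𝓡 n) x →L[ℝ] ℝ) (s : ℂ) : Prop :=
  ∃ (κ : OpenPartialHomeomorph M (Eucl n)) (hκ : κ ∈ IsManifold.maximalAtlas (𝓡 n) ∞ M)
    (φ ψ : 𝓓(chartDomain κ, ℂ)) (a : Eucl n → Eucl n → ℂ) (b : ℕ → Eucl n → Eucl n → ℂ),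
    x ∈ κ.source ∧ (∀ᶠ y in 𝓝 (κ x), φ y = 1) ∧ (∀ᶠ y in 𝓝 (κ x), ψ y = 1) ∧
    HasClassicalExpansion m a b ∧ IsLocalSymbol A hκ φ ψ a ∧
    s = b 0 (κ x) (coordCovector κ x ξ)

theorem IsClassicalPDO.exists_isPrincipalSymbolAt {m : ℝ}
    {A : SmoothFun n M →ₗ[ℂ] SmoothFun n M} (hA : IsClassicalPDO m A) (x : M)
    (ξ : TangentSpace (𝓡 n) x →L[ℝ] ℝ) : ∃ s, IsPrincipalSymbolAt m A x ξ s := by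
  have hκ := IsManifold.chart_mem_maximalAtlas (I := 𝓡 n) (n := ∞) x
  obtain ⟨φ, hφ⟩ := exists_cutoff (chartAt (Eucl n) x) (mem_chart_target (Eucl n) x)
  obtain ⟨a, b, hab, ha⟩ := hA _ hκ φ φ
  exact ⟨_, _, hκ, φ, φ, a, b, mem_chart_source _ x, hφ, hφ, hab, ha, rfl⟩

/-- The principal symbol `σ_m(A)`, a function of `x ∈ M` and `ξ ∈ T_x^*M` (only its values at
`ξ ≠ 0` are meaningful). -/
def IsClassicalPDO.principalSymbol {m : ℝ} {A : SmoothFun n M →ₗ[ℂ] SmoothFun n M}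
    (hA : IsClassicalPDO m A) (x : M) (ξ : TangentSpace (𝓡 n) x →L[ℝ] ℝ) : ℂ :=
  (hA.exists_isPrincipalSymbolAt x ξ).choose

/-! ### The Riemannian volume and the essential norm -/

variable [MeasurableSpace M]

/-- The measure `√(det (g_{ij})) dy` of a chart `κ`, carried over to `M`, where
`g_{ij}(y) = g(∂_i, ∂_j)` with the coordinate vector fields `∂_i = d(κ⁻¹)_y e_i`. -/
def chartVolume
    (g : Bundle.ContMDiffRiemannianMetric (𝓡 n) ∞ (Eucl n) (TangentSpace (𝓡 n) (M := M)))
    (κ : OpenPartialHomeomorph M (Eucl n)) : Measure M :=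
  ((volume.restrict κ.target).withDensity fun y : Eucl n =>
    ENNReal.ofReal (Real.sqrt (Matrix.det (Matrix.of fun i j : Fin n =>
      g.inner (κ.symm y)
        (mfderiv (𝓡 n) (𝓡 n) κ.symm y (EuclideanSpace.single i 1 : Eucl n))
        (mfderiv (𝓡 n) (𝓡 n) κ.symm y (EuclideanSpace.single j 1 : Eucl n)))))).map κ.symm

/-- The Riemannian volume measure of `(M, g)`: the measures `√(det (g_{ij})) dy` of any two charts
agree on the overlap, and this is the measure they glue to, i.e. their supremum in the lattice of
measures. -/
def riemannianVolume
    (g : Bundle.ContMDiffRiemannianMetric (𝓡 n) ∞ (Eucl n) (TangentSpace (𝓡 n) (M := M))) :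
    Measure M :=
  ⨆ κ ∈ IsManifold.maximalAtlas (𝓡 n) ∞ M, chartVolume g κ

/-- The `L² → L²` norm of `A - K`, as the supremum of `‖A u - K u‖` over the `u` in the unit ball
of the dense subspace `C^∞(M)` of `L²(M)`; it is `∞` if `A` is not bounded. -/
def l2NormSub (μ : Measure M) (A : SmoothFun n M →ₗ[ℂ] SmoothFun n M)
    (K : Lp ℂ 2 μ →L[ℂ] Lp ℂ 2 μ) : ENNReal :=
  ⨆ (u : SmoothFun n M) (hu : MemLp (u : M → ℂ) 2 μ) (_ : eLpNorm (u : M → ℂ) 2 μ ≤ 1),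
    eLpNorm (fun x => (A u : M → ℂ) x - K (hu.toLp (u : M → ℂ)) x) 2 μ

/-- The essential norm: the distance from `A` to the compact operators on `L²(M)`. -/
def essNorm (μ : Measure M) (A : SmoothFun n M →ₗ[ℂ] SmoothFun n M) : ENNReal :=
  ⨅ (K : Lp ℂ 2 μ →L[ℂ] Lp ℂ 2 μ) (_ : IsCompactOperator K), l2NormSub μ A K

end Manifold

end Gohberg

end

/-! On a localized, rapidly oscillating wave an operator of order zero acts almost as multiplication
by its principal symbol. Compact operators annihilate such waves in the limit, since the waves tend
weakly to zero.

Let `η ≠ 0` be the coordinates of the covector, `f` a bump near `κ x` whose transport to `M` has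
unit norm, and `v_t = κ^*(e^{it y·η} f)`, again of unit norm. Conjugating `Op(a)` by `e^{it y·η}`
replaces `a(y, ξ)` by `a(y, ξ + tη)`, which tends to `b₀(y, η)`. Dominated convergence against the
integrable `f̂` gives `|A v_t| → |b₀(·, η) f|` pointwise near `x`
(`tendsto_norm_quantize_planeWave`). By Riemann–Lebesgue `v_t → 0` weakly
(`tendsto_inner_pullback_planeWave`), so `K v_t → 0` in norm. As `‖A v_t‖ ≤ ‖A - K‖ + ‖K v_t‖`,
Fatou's lemma gives `‖b₀(·, η) f‖ ≤ ‖A - K‖`. For `c < |b₀(κ x, η)|`, a bump supported where `|b₀(·,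
η)| > c` yields `c ≤ ‖A - K‖`.

The Riemannian measure enters only through its positive continuous density in one chart
(`riemannianVolume_restrict_source`). The bound holds for every choice of chart and cutoffs, so
neither invariance of the principal symbol nor `L²`-boundedness of `A` is needed. -/

namespace Gohberg

/-! ### Charts: covectors and the Riemannian density -/

section Charts

variable {n : ℕ} {M : Type*} [TopologicalSpace M] [ChartedSpace (Eucl n) M]

theorem mdifferentiable_of_mem_maximalAtlas {κ : OpenPartialHomeomorph M (Eucl n)}
    (hκ : κ ∈ IsManifold.maximalAtlas (𝓡 n) ∞ M) : κ.MDifferentiable (𝓡 n) (𝓡 n) :=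
  ⟨(contMDiffOn_of_mem_maximalAtlas hκ).mdifferentiableOn (by simp),
    (contMDiffOn_symm_of_mem_maximalAtlas hκ).mdifferentiableOn (by simp)⟩

/-- The differential of a chart is invertible. The homogeneous terms of a symbol are smooth and
homogeneous only off the zero section, so the coordinates of `ξ` must stay away from `0`. -/
theorem coordCovector_ne_zero {κ : OpenPartialHomeomorph M (Eucl n)}
    (hκ : κ ∈ IsManifold.maximalAtlas (𝓡 n) ∞ M) {x : M} (hx : x ∈ κ.source)
    {ξ : TangentSpace (𝓡 n) x →L[ℝ] ℝ} (hξ : ξ ≠ 0) : coordCovector κ x ξ ≠ 0 := by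
  intro h
  apply hξ
  have hinv : (mfderiv (𝓡 n) (𝓡 n) κ x).IsInvertible :=
    ⟨(mdifferentiable_of_mem_maximalAtlas hκ).mfderiv hx, rfl⟩
  have h0 : ξ.comp (mfderiv (𝓡 n) (𝓡 n) κ x).inverse = 0 := by
    have := congrArg (InnerProductSpace.toDual ℝ (Eucl n)) h
    rw [map_zero, coordCovector, LinearIsometryEquiv.apply_symm_apply] at this
    exact this
  ext v
  have h1 := DFunLike.congr_fun h0 (mfderiv (𝓡 n) (𝓡 n) κ x v)
  rw [ContinuousLinearMap.comp_apply] at h1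
  have h2 : (mfderiv (𝓡 n) (𝓡 n) κ x).inverse (mfderiv (𝓡 n) (𝓡 n) κ x v) = v :=
    DFunLike.congr_fun hinv.inverse_comp_self v
  rw [h2] at h1
  exact h1

variable [IsManifold (𝓡 n) ∞ M]

/-- The Gram matrix `g_{ij}(y)` of the coordinate vector fields of the chart `κ`. -/
noncomputable def gramMatrix
    (g : Bundle.ContMDiffRiemannianMetric (𝓡 n) ∞ (Eucl n) (TangentSpace (𝓡 n) (M := M)))
    (κ : OpenPartialHomeomorph M (Eucl n)) (y : Eucl n) : Matrix (Fin n) (Fin n) ℝ :=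
  Matrix.of fun i j : Fin n =>
    g.inner (κ.symm y)
      (mfderiv (𝓡 n) (𝓡 n) κ.symm y (EuclideanSpace.single i 1 : Eucl n))
      (mfderiv (𝓡 n) (𝓡 n) κ.symm y (EuclideanSpace.single j 1 : Eucl n))

/-- The density `√(det (g_{ij}))` of the Riemannian volume in the chart `κ`. -/
noncomputable def volumeDensity
    (g : Bundle.ContMDiffRiemannianMetric (𝓡 n) ∞ (Eucl n) (TangentSpace (𝓡 n) (M := M)))
    (κ : OpenPartialHomeomorph M (Eucl n)) (y : Eucl n) : ℝ :=
  Real.sqrt (gramMatrix g κ y).det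

variable (g : Bundle.ContMDiffRiemannianMetric (𝓡 n) ∞ (Eucl n)
  (TangentSpace (𝓡 n) (M := M)))

/-- The pullback of the metric `g` along the inverse of the chart `κ`, as a bilinear form. -/
noncomputable def pullbackForm (κ : OpenPartialHomeomorph M (Eucl n)) (y : Eucl n) :
    LinearMap.BilinForm ℝ (Eucl n) :=
  LinearMap.mk₂ ℝ (fun v w : Eucl n => g.inner (κ.symm y)
      (mfderiv (𝓡 n) (𝓡 n) κ.symm y v) (mfderiv (𝓡 n) (𝓡 n) κ.symm y w))
    (fun v v' w => by
      rw [show mfderiv (𝓡 n) (𝓡 n) κ.symm y (v + v') = mfderiv (𝓡 n) (𝓡 n) κ.symm y v +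
        mfderiv (𝓡 n) (𝓡 n) κ.symm y v' from map_add _ _ _, map_add]; rfl)
    (fun c v w => by
      rw [show mfderiv (𝓡 n) (𝓡 n) κ.symm y (c • v) = c • mfderiv (𝓡 n) (𝓡 n) κ.symm y v from
        map_smul _ _ _, map_smul]; rfl)
    (fun v w w' => by
      rw [show mfderiv (𝓡 n) (𝓡 n) κ.symm y (w + w') = mfderiv (𝓡 n) (𝓡 n) κ.symm y w +
        mfderiv (𝓡 n) (𝓡 n) κ.symm y w' from map_add _ _ _, map_add])
    (fun c v w => by
      rw [show mfderiv (𝓡 n) (𝓡 n) κ.symm y (c • w) = c • mfderiv (𝓡 n) (𝓡 n) κ.symm y w from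
        map_smul _ _ _, map_smul])

theorem gramMatrix_eq_toMatrix (κ : OpenPartialHomeomorph M (Eucl n)) (y : Eucl n) :
    gramMatrix g κ y =
      LinearMap.BilinForm.toMatrix (EuclideanSpace.basisFun (Fin n) ℝ).toBasis
        (pullbackForm g κ y) := by
  ext i j
  simp [gramMatrix, LinearMap.BilinForm.toMatrix_apply, pullbackForm]

theorem gramMatrix_posDef {κ : OpenPartialHomeomorph M (Eucl n)}
    (hκ : κ ∈ IsManifold.maximalAtlas (𝓡 n) ∞ M) {y : Eucl n} (hy : y ∈ κ.target) :
    (gramMatrix g κ y).PosDef := by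
  refine Matrix.PosDef.of_dotProduct_mulVec_pos ?_ ?_
  · ext i j
    simp only [gramMatrix, Matrix.conjTranspose_apply, Matrix.of_apply, star_trivial]
    exact g.symm _ _ _
  · intro v hv
    let b := (EuclideanSpace.basisFun (Fin n) ℝ).toBasis
    have hv0 : b.equivFun.symm v ≠ 0 :=
      (LinearEquiv.map_ne_zero_iff _).2 hv
    have hd : mfderiv (𝓡 n) (𝓡 n) κ.symm y (b.equivFun.symm v) ≠ 0 := by
      intro h
      exact hv0 ((mdifferentiable_of_mem_maximalAtlas hκ).symm.mfderiv_injective hy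
        (h.trans (map_zero (mfderiv (𝓡 n) (𝓡 n) κ.symm y)).symm))
    have hp := g.pos _ _ hd
    have key : pullbackForm g κ y (b.equivFun.symm v) (b.equivFun.symm v) =
        star v ⬝ᵥ (gramMatrix g κ y).mulVec v := by
      rw [gramMatrix_eq_toMatrix, LinearMap.BilinForm.apply_eq_dotProduct_toMatrix_mulVec b]
      have hr : ⇑(b.repr (b.equivFun.symm v)) = v := b.equivFun.apply_symm_apply v
      rw [hr, star_trivial]
    rw [← key]
    exact hp

theorem volumeDensity_pos {κ : OpenPartialHomeomorph M (Eucl n)}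
    (hκ : κ ∈ IsManifold.maximalAtlas (𝓡 n) ∞ M) {y : Eucl n} (hy : y ∈ κ.target) :
    0 < volumeDensity g κ y :=
  Real.sqrt_pos.2 (gramMatrix_posDef g hκ hy).det_pos

theorem continuousOn_volumeDensity {κ : OpenPartialHomeomorph M (Eucl n)}
    (hκ : κ ∈ IsManifold.maximalAtlas (𝓡 n) ∞ M) :
    ContinuousOn (volumeDensity g κ) κ.target := by
  -- The tangent map of `κ.symm` is continuous on the tangent bundle; composing it with the constant
  -- section `y ↦ (y, v)` gives a continuous coordinate vector field.
  have hvec : ∀ v : Eucl n, ContinuousOn (fun y : Eucl n =>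
      (⟨κ.symm y, mfderiv (𝓡 n) (𝓡 n) κ.symm y v⟩ : TangentBundle (𝓡 n) M)) κ.target := by
    intro v
    have h1 := (contMDiffOn_symm_of_mem_maximalAtlas hκ).continuousOn_tangentMapWithin
      (by simp) κ.open_target.uniqueMDiffOn
    have h2 : Continuous (fun y : Eucl n => (⟨y, v⟩ : TangentBundle (𝓡 n) (Eucl n))) := by
      have := (tangentBundleModelSpaceHomeomorph (𝓡 n)).symm.continuous.comp
        (Continuous.prodMk_left v)
      exact this
    have h3 := h1.comp h2.continuousOn (fun y hy => hy) (t := _) (s := κ.target)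
    refine h3.congr fun y hy => ?_
    simp [tangentMapWithin, mfderivWithin_of_isOpen κ.open_target hy]
  have hent : ∀ i j, ContinuousOn (fun y => gramMatrix g κ y i j) κ.target := by
    intro i j y hy
    have h : ContinuousWithinAt (fun y => Bundle.TotalSpace.mk' ℝ (E := Bundle.Trivial M ℝ)
        (κ.symm y) (gramMatrix g κ y i j)) κ.target y :=
      (g.contMDiff.continuous.continuousAt.comp_continuousWithinAt
        (κ.continuousOn_symm y hy)).clm_bundle_apply₂ (F₁ := Eucl n) (F₂ := Eucl n)
        (hvec (EuclideanSpace.single i 1) y hy) (hvec (EuclideanSpace.single j 1) y hy)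
    simp only [FiberBundle.continuousWithinAt_totalSpace] at h
    exact h.2
  have hdet : ContinuousOn (fun y => (gramMatrix g κ y).det) κ.target := by
    simp only [Matrix.det_apply]
    fun_prop
  exact hdet.sqrt

/-- With `T` the derivative of the transition map, the Gram matrices are related by congruence with
the matrix of `T`, so their determinants differ by `(det T)²`. -/
theorem volumeDensity_eq_abs_det_mul {κ κ' : OpenPartialHomeomorph M (Eucl n)}
    (hκ : κ ∈ IsManifold.maximalAtlas (𝓡 n) ∞ M) (hκ' : κ' ∈ IsManifold.maximalAtlas (𝓡 n) ∞ M)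
    {y : Eucl n} (hy : y ∈ κ.target) (hy' : κ.symm y ∈ κ'.source) :
    volumeDensity g κ y =
      |(fderiv ℝ (κ' ∘ κ.symm) y).det| * volumeDensity g κ' (κ' (κ.symm y)) := by
  have hd := (mdifferentiable_of_mem_maximalAtlas hκ).mdifferentiableAt_symm hy
  have hd' := (mdifferentiable_of_mem_maximalAtlas hκ').mdifferentiableAt hy'
  have hinv := (mdifferentiable_of_mem_maximalAtlas hκ').symm_comp_deriv hy'
  have hfd : fderiv ℝ (κ' ∘ κ.symm) y =
      (mfderiv (𝓡 n) (𝓡 n) κ' (κ.symm y)).comp (mfderiv (𝓡 n) (𝓡 n) κ.symm y) := by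
    rw [← mfderiv_eq_fderiv]
    exact mfderiv_comp y hd' hd
  set T : Eucl n →ₗ[ℝ] Eucl n := (fderiv ℝ (κ' ∘ κ.symm) y : Eucl n →ₗ[ℝ] Eucl n) with hT
  have hcomp : ∀ v : Eucl n, mfderiv (𝓡 n) (𝓡 n) κ'.symm (κ' (κ.symm y)) (T v) =
      mfderiv (𝓡 n) (𝓡 n) κ.symm y v := by
    intro v
    have := DFunLike.congr_fun hinv (mfderiv (𝓡 n) (𝓡 n) κ.symm y v)
    rw [hT, hfd]
    exact this
  have hform : pullbackForm g κ y = (pullbackForm g κ' (κ' (κ.symm y))).comp T T := by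
    refine LinearMap.ext₂ fun v w => ?_
    -- The base points `κ.symm y` and `κ'.symm (κ' (κ.symm y))` are equal but not definitionally so;
    -- all tangent spaces being copies of `Eucl n`, the metric can be rewritten along that equality.
    have hpt : ∀ p q : M, p = q → ∀ v w : Eucl n, g.inner p v w = g.inner q v w := by
      rintro _ _ rfl _ _
      rfl
    change g.inner (κ.symm y) (mfderiv (𝓡 n) (𝓡 n) κ.symm y v)
        (mfderiv (𝓡 n) (𝓡 n) κ.symm y w) =
      g.inner (κ'.symm (κ' (κ.symm y))) (mfderiv (𝓡 n) (𝓡 n) κ'.symm (κ' (κ.symm y)) (T v))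
        (mfderiv (𝓡 n) (𝓡 n) κ'.symm (κ' (κ.symm y)) (T w))
    rw [← hcomp v, ← hcomp w]
    exact hpt _ _ (κ'.left_inv hy').symm _ _
  have hdet : (gramMatrix g κ y).det =
      T.det ^ 2 * (gramMatrix g κ' (κ' (κ.symm y))).det := by
    rw [gramMatrix_eq_toMatrix, gramMatrix_eq_toMatrix, hform,
      LinearMap.BilinForm.toMatrix_comp (EuclideanSpace.basisFun (Fin n) ℝ).toBasis
        (EuclideanSpace.basisFun (Fin n) ℝ).toBasis,
      Matrix.det_mul, Matrix.det_mul, Matrix.det_transpose, LinearMap.det_toMatrix]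
    ring
  rw [volumeDensity, hdet, Real.sqrt_mul (sq_nonneg _), Real.sqrt_sq_eq_abs]
  rfl

end Charts

end Gohberg

namespace Gohberg

/-! ### The Riemannian volume in a chart -/

section Volume

variable {n : ℕ} {M : Type*} [TopologicalSpace M] [MeasurableSpace M]

theorem measurableSet_target_inter_preimage_symm [BorelSpace M]
    (κ : OpenPartialHomeomorph M (Eucl n))
    {s : Set M} (hs : MeasurableSet s) : MeasurableSet (κ.target ∩ κ.symm ⁻¹' s) := by
  have h := (continuousOn_iff_continuous_domRestrict.1 κ.continuousOn_symm).measurable hs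
  have h2 := κ.open_target.measurableSet.subtype_image h
  convert h2 using 1
  ext y
  simp [and_comm]

variable [ChartedSpace (Eucl n) M] [IsManifold (𝓡 n) ∞ M]
  (g : Bundle.ContMDiffRiemannianMetric (𝓡 n) ∞ (Eucl n) (TangentSpace (𝓡 n) (M := M)))

theorem chartVolume_eq_map (κ : OpenPartialHomeomorph M (Eucl n)) :
    chartVolume g κ = ((volume.restrict κ.target).withDensity
      fun y => ENNReal.ofReal (volumeDensity g κ y)).map κ.symm :=
  rfl

variable [BorelSpace M]

theorem aemeasurable_symm (κ : OpenPartialHomeomorph M (Eucl n)) :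
    AEMeasurable κ.symm ((volume.restrict κ.target).withDensity
      fun y => ENNReal.ofReal (volumeDensity g κ y)) :=
  (κ.continuousOn_symm.aemeasurable κ.open_target.measurableSet).mono_ac
    (withDensity_absolutelyContinuous _ _)

theorem chartVolume_apply (κ : OpenPartialHomeomorph M (Eucl n)) {s : Set M}
    (hs : MeasurableSet s) :
    chartVolume g κ s =
      ∫⁻ y in κ.target ∩ κ.symm ⁻¹' s, ENNReal.ofReal (volumeDensity g κ y) := by
  rw [chartVolume_eq_map, Measure.map_apply_of_aemeasurable (aemeasurable_symm g κ) hs,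
    withDensity_apply', Measure.restrict_restrict' κ.open_target.measurableSet, inter_comm]

/-- Change of variables along the transition map makes both measures agree on the overlap. An
inequality suffices, because the chart `κ` is itself a member of the supremum defining the volume.
-/
theorem chartVolume_restrict_le {κ κ' : OpenPartialHomeomorph M (Eucl n)}
    (hκ : κ ∈ IsManifold.maximalAtlas (𝓡 n) ∞ M)
    (hκ' : κ' ∈ IsManifold.maximalAtlas (𝓡 n) ∞ M) :
    (chartVolume g κ').restrict κ.source ≤ chartVolume g κ := by
  refine Measure.le_iff.2 fun s hs => ?_
  rw [Measure.restrict_apply hs, chartVolume_apply g κ' (hs.inter κ.open_source.measurableSet),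
    chartVolume_apply g κ hs]
  set D : Set (Eucl n) := κ.target ∩ κ.symm ⁻¹' (s ∩ κ'.source) with hD
  have hDm : MeasurableSet D :=
    measurableSet_target_inter_preimage_symm κ (hs.inter κ'.open_source.measurableSet)
  have himage : κ'.target ∩ κ'.symm ⁻¹' (s ∩ κ.source) = (κ' ∘ κ.symm) '' D := by
    ext z
    constructor
    · rintro ⟨hz, hzs, hzκ⟩
      refine ⟨κ (κ'.symm z), ⟨κ.map_source hzκ, ?_, ?_⟩, ?_⟩
      · simpa [κ.left_inv hzκ] using hzs
      · simpa [κ.left_inv hzκ] using κ'.map_target hz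
      · simp [κ.left_inv hzκ, κ'.right_inv hz]
    · rintro ⟨y, ⟨hy, hys, hyκ⟩, rfl⟩
      refine ⟨κ'.map_source hyκ, ?_, ?_⟩
      · simpa [κ'.left_inv hyκ] using hys
      · simpa [κ'.left_inv hyκ] using κ.map_target hy
  have hinj : InjOn (κ' ∘ κ.symm) D := by
    rintro y ⟨hy, -, hyκ⟩ z ⟨hz, -, hzκ⟩ h
    exact κ.symm.injOn hy hz (κ'.injOn hyκ hzκ h)
  have hderiv : ∀ y ∈ D, HasFDerivWithinAt (κ' ∘ κ.symm) (fderiv ℝ (κ' ∘ κ.symm) y) D y := by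
    rintro y ⟨hy, -, hyκ⟩
    have h1 := (mdifferentiable_of_mem_maximalAtlas hκ).mdifferentiableAt_symm hy
    have h2 := (mdifferentiable_of_mem_maximalAtlas hκ').mdifferentiableAt hyκ
    exact (mdifferentiableAt_iff_differentiableAt.1
      (h2.comp y h1)).hasFDerivAt.hasFDerivWithinAt
  rw [himage, lintegral_image_eq_lintegral_abs_det_fderiv_mul volume hDm hderiv hinj]
  calc _ = ∫⁻ y in D, ENNReal.ofReal (volumeDensity g κ y) := by
        refine setLIntegral_congr_fun hDm fun y hy => ?_
        simp only [Function.comp_apply]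
        rw [volumeDensity_eq_abs_det_mul g hκ hκ' hy.1 hy.2.2, ENNReal.ofReal_mul (abs_nonneg _)]
    _ ≤ _ := lintegral_mono_set
        (inter_subset_inter_right _ (preimage_mono inter_subset_left))

theorem chartVolume_compl_source (κ : OpenPartialHomeomorph M (Eucl n)) :
    chartVolume g κ κ.sourceᶜ = 0 := by
  rw [chartVolume_apply g κ κ.open_source.measurableSet.compl]
  have : κ.target ∩ κ.symm ⁻¹' κ.sourceᶜ = ∅ := by
    ext y
    simpa using fun hy => κ.map_target hy
  rw [this, Measure.restrict_empty, lintegral_zero_measure]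

/-- This reduces the supremum over all charts to a single density, so that integrals over the chart
can be computed in coordinates. -/
theorem riemannianVolume_restrict_source {κ : OpenPartialHomeomorph M (Eucl n)}
    (hκ : κ ∈ IsManifold.maximalAtlas (𝓡 n) ∞ M) :
    (riemannianVolume g).restrict κ.source = chartVolume g κ := by
  have hms := κ.open_source.measurableSet
  refine le_antisymm ?_ ?_
  · have hle : riemannianVolume g ≤
        chartVolume g κ + (⊤ : Measure M).restrict κ.sourceᶜ := by
      refine iSup₂_le fun κ' hκ' => ?_
      rw [← Measure.restrict_add_restrict_compl (μ := chartVolume g κ') hms]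
      exact add_le_add (chartVolume_restrict_le g hκ hκ') (Measure.restrict_mono le_rfl le_top)
    calc (riemannianVolume g).restrict κ.source
        ≤ (chartVolume g κ + (⊤ : Measure M).restrict κ.sourceᶜ).restrict κ.source :=
          Measure.restrict_mono le_rfl hle
      _ = (chartVolume g κ).restrict κ.source := by
          rw [Measure.restrict_add, Measure.restrict_restrict hms]
          simp
      _ ≤ chartVolume g κ := Measure.restrict_le_self
  · have h : (chartVolume g κ).restrict κ.source = chartVolume g κ :=
      Measure.restrict_eq_self_of_ae_mem (chartVolume_compl_source g κ)
    rw [← h]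
    exact Measure.restrict_mono le_rfl (le_iSup₂_of_le κ hκ le_rfl)

theorem riemannianVolume_preimage_inter_source {κ : OpenPartialHomeomorph M (Eucl n)}
    (hκ : κ ∈ IsManifold.maximalAtlas (𝓡 n) ∞ M) {B : Set (Eucl n)} (hB : IsOpen B)
    (hBt : B ⊆ κ.target) :
    riemannianVolume g (κ.source ∩ κ ⁻¹' B) =
      ∫⁻ y in B, ENNReal.ofReal (volumeDensity g κ y) := by
  have hm : MeasurableSet (κ.source ∩ κ ⁻¹' B) :=
    (κ.isOpen_inter_preimage hB).measurableSet
  have h : riemannianVolume g (κ.source ∩ κ ⁻¹' B) = chartVolume g κ (κ.source ∩ κ ⁻¹' B) := by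
    rw [← riemannianVolume_restrict_source g hκ, Measure.restrict_apply hm]
    congr 1
    exact (inter_eq_self_of_subset_left inter_subset_left).symm
  rw [h, chartVolume_apply g κ hm]
  congr 2
  ext y
  constructor
  · rintro ⟨hy, -, hyB⟩
    simpa [κ.right_inv hy] using hyB
  · intro hy
    exact ⟨hBt hy, κ.map_target (hBt hy), by simpa [κ.right_inv (hBt hy)] using hy⟩

theorem riemannianVolume_preimage_pos {κ : OpenPartialHomeomorph M (Eucl n)}
    (hκ : κ ∈ IsManifold.maximalAtlas (𝓡 n) ∞ M) {B : Set (Eucl n)} (hB : IsOpen B)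
    (hBt : B ⊆ κ.target) (hne : B.Nonempty) :
    0 < riemannianVolume g (κ.source ∩ κ ⁻¹' B) := by
  rw [riemannianVolume_preimage_inter_source g hκ hB hBt]
  have hmeas : AEMeasurable (fun y => ENNReal.ofReal (volumeDensity g κ y))
      (volume.restrict B) :=
    (((continuousOn_volumeDensity g hκ).mono hBt).aemeasurable hB.measurableSet).ennreal_ofReal
  rw [pos_iff_ne_zero, Ne, lintegral_eq_zero_iff' hmeas]
  intro h0
  have hpos := hB.measure_pos volume hne
  have h1 : ∀ᵐ y ∂(volume.restrict B), False := by
    filter_upwards [h0, ae_restrict_mem hB.measurableSet] with y hy hyB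
    have := volumeDensity_pos g hκ (hBt hyB)
    simp only [Pi.zero_apply, ENNReal.ofReal_eq_zero] at hy
    linarith
  rw [eventually_false_iff_eq_bot, ae_eq_bot, Measure.restrict_eq_zero] at h1
  exact hpos.ne' h1

theorem riemannianVolume_preimage_ball_lt_top {κ : OpenPartialHomeomorph M (Eucl n)}
    (hκ : κ ∈ IsManifold.maximalAtlas (𝓡 n) ∞ M) {y₀ : Eucl n} {r : ℝ}
    (hr : Metric.closedBall y₀ r ⊆ κ.target) :
    riemannianVolume g (κ.source ∩ κ ⁻¹' Metric.ball y₀ r) < ⊤ := by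
  rw [riemannianVolume_preimage_inter_source g hκ Metric.isOpen_ball
    (Metric.ball_subset_closedBall.trans hr)]
  obtain ⟨C, hC⟩ := (isCompact_closedBall y₀ r).exists_bound_of_continuousOn
    ((continuousOn_volumeDensity g hκ).mono hr)
  calc _ ≤ ∫⁻ y in Metric.ball y₀ r, ENNReal.ofReal C := by
        refine setLIntegral_mono measurable_const fun y hy => ENNReal.ofReal_le_ofReal ?_
        exact (le_abs_self _).trans (hC y (Metric.ball_subset_closedBall hy))
    _ < ⊤ := by
        rw [setLIntegral_const]
        exact ENNReal.mul_lt_top ENNReal.ofReal_lt_top measure_ball_lt_top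

end Volume

end Gohberg

namespace Gohberg

/-! ### Quantized symbols acting on plane waves -/

section Quantization

variable {n : ℕ}

theorem IsSymbol.exists_norm_le {a : Eucl n → Eucl n → ℂ} (ha : IsSymbol 0 a) :
    ∃ C : ℝ, ∀ x ξ, ‖a x ξ‖ ≤ C := by
  obtain ⟨C, hC⟩ := ha.2 0 0
  refine ⟨C, fun x ξ => ?_⟩
  have h := hC x ξ (mem_univ _)
  simpa [norm_iteratedFDeriv_zero] using h

theorem tendsto_norm_add_smul {η : Eucl n} (hη : η ≠ 0) (ξ : Eucl n) :
    Tendsto (fun t : ℝ => ‖ξ + t • η‖) atTop atTop := by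
  have h1 : Tendsto (fun t : ℝ => t * ‖η‖ - ‖ξ‖) atTop atTop :=
    tendsto_atTop_add_const_right _ _ (tendsto_id.atTop_mul_const (norm_pos_iff.2 hη))
  refine tendsto_atTop_mono' _ ?_ h1
  filter_upwards [eventually_ge_atTop 0] with t ht
  have h2 : ‖t • η‖ = t * ‖η‖ := by rw [norm_smul, Real.norm_of_nonneg ht]
  have h3 : ‖t • η‖ ≤ ‖ξ + t • η‖ + ‖ξ‖ := by
    simpa using norm_sub_le (ξ + t • η) ξ
  linarith

/-- Along a ray, a classical symbol of order zero converges to its leading homogeneous term. -/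
theorem HasClassicalExpansion.tendsto_add_smul {a : Eucl n → Eucl n → ℂ}
    {b : ℕ → Eucl n → Eucl n → ℂ} (h : HasClassicalExpansion 0 a b) (y ξ : Eucl n)
    {η : Eucl n} (hη : η ≠ 0) :
    Tendsto (fun t : ℝ => a y (ξ + t • η)) atTop (𝓝 (b 0 y η)) := by
  have hnorm := tendsto_norm_add_smul hη ξ
  have hrem : Tendsto (fun t : ℝ => a y (ξ + t • η) - b 0 y (ξ + t • η)) atTop (𝓝 0) := by
    -- After subtracting one term the remainder has order `-1`; no derivatives are needed.
    obtain ⟨C, hC⟩ := h.remainder 1 0 0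
    have hlim : Tendsto (fun t : ℝ => C * (1 + ‖ξ + t • η‖)⁻¹) atTop (𝓝 0) := by
      simpa using ((tendsto_atTop_add_const_left _ 1 hnorm).inv_tendsto_atTop).const_mul C
    refine squeeze_zero_norm' ?_ hlim
    filter_upwards [hnorm.eventually_ge_atTop 1] with t ht
    have := hC y (ξ + t • η) ht
    simpa [norm_iteratedFDeriv_zero, Real.rpow_neg_one] using this
  have hlead : Tendsto (fun t : ℝ => b 0 y (ξ + t • η)) atTop (𝓝 (b 0 y η)) := by
    have hopen : IsOpen {p : Eucl n × Eucl n | p.2 ≠ 0} :=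
      isOpen_ne_fun continuous_snd continuous_const
    have hcont : ContinuousAt (fun p : Eucl n × Eucl n => b 0 p.1 p.2) (y, η) :=
      (h.smooth 0).continuousOn.continuousAt (hopen.mem_nhds hη)
    have harg : Tendsto (fun t : ℝ => (y, t⁻¹ • ξ + η)) atTop (𝓝 (y, η)) := by
      -- Homogeneity of degree zero gives `b₀(y, ξ + tη) = b₀(y, t⁻¹ξ + η)`, which reduces the limit
      -- to continuity at `η`.
      have : Tendsto (fun t : ℝ => t⁻¹ • ξ + η) atTop (𝓝 η) := by
        simpa using ((tendsto_inv_atTop_zero (𝕜 := ℝ)).smul_const ξ).add_const η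
      exact tendsto_const_nhds.prodMk_nhds this
    refine (hcont.tendsto.comp harg).congr' ?_
    filter_upwards [eventually_gt_atTop 0, hnorm.eventually_gt_atTop 0] with t ht hpos
    have hsm : ξ + t • η = t • (t⁻¹ • ξ + η) := by
      rw [smul_add, smul_inv_smul₀ ht.ne']
    have hne : t⁻¹ • ξ + η ≠ 0 := by
      rintro h0
      rw [hsm, h0] at hpos
      simp at hpos
    rw [hsm, h.homogeneous 0 y _ hne t ht]
    simp
  simpa using hrem.add hlead

/-- The Fourier transform `∫ e^{-i y·ξ} f(y) dy`. -/
noncomputable def hat (f : Eucl n → ℂ) (ξ : Eucl n) : ℂ :=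
  ∫ y : Eucl n, Complex.exp (-(Complex.I * (inner ℝ y ξ : ℝ))) * f y

open scoped FourierTransform

theorem hat_eq_fourier (f : Eucl n → ℂ) (ξ : Eucl n) :
    hat f ξ = 𝓕 f ((2 * Real.pi)⁻¹ • ξ) := by
  rw [hat, Real.fourier_eq']
  congr 1
  ext y
  rw [smul_eq_mul, real_inner_smul_right]
  congr 2
  push_cast
  field_simp

theorem integrable_hat (f : 𝓢(Eucl n, ℂ)) : Integrable (hat f) := by
  have h : hat f = fun ξ => (𝓕 f) ((2 * Real.pi)⁻¹ • ξ) := by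
    ext ξ
    rw [hat_eq_fourier, SchwartzMap.fourier_coe]
  rw [h]
  exact (integrable_comp_smul_iff volume _ (by positivity)).2 (𝓕 f).integrable

theorem hat_inversion (f : 𝓢(Eucl n, ℂ)) (y : Eucl n) :
    ((2 * Real.pi : ℝ) : ℂ)⁻¹ ^ n *
      ∫ ξ : Eucl n, Complex.exp (Complex.I * (inner ℝ y ξ : ℝ)) * hat f ξ = f y := by
  have hinv : 𝓕⁻ (𝓕 (f : Eucl n → ℂ)) = f :=
    f.continuous.fourierInv_fourier_eq f.integrable (𝓕 f).integrable
  have h1 : f y = ∫ ξ : Eucl n, Complex.exp (((2 * Real.pi * inner ℝ ξ y : ℝ) : ℂ) * Complex.I) *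
      𝓕 (f : Eucl n → ℂ) ξ := by
    conv_lhs => rw [← hinv, Real.fourierInv_eq']
    rfl
  -- The substitution `ξ ↦ ξ / 2π` passes between the two Fourier conventions and produces the
  -- factor `(2π)ⁿ`.
  have h2 := Measure.integral_comp_smul (volume : Measure (Eucl n))
    (fun ξ => Complex.exp (((2 * Real.pi * inner ℝ ξ y : ℝ) : ℂ) * Complex.I) *
      𝓕 (f : Eucl n → ℂ) ξ) (2 * Real.pi)⁻¹
  rw [← h1, finrank_euclideanSpace_fin] at h2
  have h3 : ∫ ξ : Eucl n, Complex.exp (Complex.I * (inner ℝ y ξ : ℝ)) * hat f ξ =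
      ((2 * Real.pi : ℝ) ^ n) • f y := by
    rw [inv_pow, inv_inv, abs_of_pos (by positivity)] at h2
    rw [← h2]
    congr 1
    ext ξ
    rw [hat_eq_fourier, real_inner_smul_left, real_inner_comm ξ y]
    congr 2
    push_cast
    field_simp
  rw [h3, Complex.real_smul, ← mul_assoc]
  push_cast
  rw [← mul_pow, inv_mul_cancel₀ (by simp [Real.pi_ne_zero]), one_pow, one_mul]

/-- The function `y ↦ e^{i y·ζ} f(y)` for smooth compactly supported `f`. -/
noncomputable def planeWave {f : Eucl n → ℂ} (hf : HasCompactSupport f) (hfs : ContDiff ℝ ∞ f)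
    (ζ : Eucl n) : 𝓢(Eucl n, ℂ) :=
  (hf.mul_left (f := fun y => Complex.exp (Complex.I * (inner ℝ y ζ : ℝ)))).toSchwartzMap
    (ContDiff.mul (by
      have : ContDiff ℝ ∞ fun y : Eucl n => ((inner ℝ y ζ : ℝ) : ℂ) :=
        Complex.ofRealCLM.contDiff.comp (contDiff_id.inner ℝ contDiff_const)
      exact (contDiff_const.mul this).cexp) hfs)

theorem planeWave_apply {f : Eucl n → ℂ} (hf : HasCompactSupport f) (hfs : ContDiff ℝ ∞ f)
    (ζ y : Eucl n) :
    planeWave hf hfs ζ y = Complex.exp (Complex.I * (inner ℝ y ζ : ℝ)) * f y :=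
  rfl

theorem norm_exp_I_mul_ofReal (t : ℝ) : ‖Complex.exp (Complex.I * t)‖ = 1 := by
  rw [mul_comm]
  exact Complex.norm_exp_ofReal_mul_I t

/-- Modulation by `e^{i y·ζ}` translates the Fourier transform by `ζ`; translating the integration
variable back moves the shift into the symbol. -/
theorem quantize_planeWave (a : Eucl n → Eucl n → ℂ) {f : Eucl n → ℂ} (hf : HasCompactSupport f)
    (hfs : ContDiff ℝ ∞ f) (ζ y : Eucl n) :
    quantize a (planeWave hf hfs ζ) y = Complex.exp (Complex.I * (inner ℝ y ζ : ℝ)) *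
      (((2 * Real.pi : ℝ) : ℂ)⁻¹ ^ n *
        ∫ ξ : Eucl n, Complex.exp (Complex.I * (inner ℝ y ξ : ℝ)) * a y (ξ + ζ) * hat f ξ) := by
  have hshift : ∀ ξ : Eucl n,
      ∫ z : Eucl n, Complex.exp (-(Complex.I * (inner ℝ z ξ : ℝ))) * planeWave hf hfs ζ z =
        hat f (ξ - ζ) := by
    intro ξ
    rw [hat]
    congr 1
    ext z
    rw [planeWave_apply, ← mul_assoc, ← Complex.exp_add, inner_sub_right]
    congr 2
    push_cast
    ring
  rw [quantize]
  simp_rw [hshift]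
  rw [← integral_add_right_eq_self _ ζ, mul_left_comm]
  congr 1
  rw [← integral_const_mul]
  congr 1
  ext ξ
  rw [add_sub_cancel_right, inner_add_right]
  push_cast
  rw [mul_add, Complex.exp_add]
  ring

/-- The operator `Op(a)` acts on highly oscillating plane waves through its leading symbol. -/
theorem tendsto_norm_quantize_planeWave {a : Eucl n → Eucl n → ℂ}
    {b : ℕ → Eucl n → Eucl n → ℂ} (h : HasClassicalExpansion 0 a b) {f : Eucl n → ℂ}
    (hf : HasCompactSupport f) (hfs : ContDiff ℝ ∞ f) {η : Eucl n} (hη : η ≠ 0) (y : Eucl n) :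
    Tendsto (fun t : ℝ => ‖quantize a (planeWave hf hfs (t • η)) y‖) atTop
      (𝓝 ‖b 0 y η * f y‖) := by
  simp_rw [quantize_planeWave, norm_mul _ (((2 * Real.pi : ℝ) : ℂ)⁻¹ ^ n * _),
    norm_exp_I_mul_ofReal, one_mul]
  apply Tendsto.norm
  have hF : Integrable (hat f) := integrable_hat (hf.toSchwartzMap hfs)
  have hinv : ((2 * Real.pi : ℝ) : ℂ)⁻¹ ^ n *
      ∫ ξ : Eucl n, Complex.exp (Complex.I * (inner ℝ y ξ : ℝ)) * hat f ξ = f y :=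
    hat_inversion (hf.toSchwartzMap hfs) y
  have hlim : b 0 y η * f y = ((2 * Real.pi : ℝ) : ℂ)⁻¹ ^ n *
      ∫ ξ : Eucl n, Complex.exp (Complex.I * (inner ℝ y ξ : ℝ)) * b 0 y η * hat f ξ := by
    rw [← hinv, mul_left_comm, ← integral_const_mul]
    congr 2
    ext ξ
    ring
  rw [hlim]
  apply Tendsto.const_mul
  obtain ⟨C, hC⟩ := h.isSymbol.exists_norm_le
  refine tendsto_integral_filter_of_dominated_convergence (fun ξ => C * ‖hat f ξ‖) ?_ ?_ ?_ ?_
  · refine Eventually.of_forall fun t => ?_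
    have ha : Continuous fun ξ : Eucl n => a y (ξ + t • η) :=
      h.isSymbol.1.continuous.comp (by fun_prop : Continuous fun ξ : Eucl n => (y, ξ + t • η))
    have he : Continuous fun ξ : Eucl n => Complex.exp (Complex.I * (inner ℝ y ξ : ℝ)) := by
      fun_prop
    exact (he.mul ha).aestronglyMeasurable.mul hF.aestronglyMeasurable
  · refine Eventually.of_forall fun t => Eventually.of_forall fun ξ => ?_
    rw [norm_mul, norm_mul, norm_exp_I_mul_ofReal, one_mul]
    gcongr
    exact hC _ _
  · exact hF.norm.const_mul C
  · refine Eventually.of_forall fun ξ => ?_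
    exact ((h.tendsto_add_smul y ξ hη).const_mul _).mul_const _

end Quantization

end Gohberg

/-! ### Weakly null waves on the manifold and the norm estimate -/

namespace Gohberg

/-- A compact operator maps bounded weakly null sequences to null sequences. -/
theorem tendsto_apply_zero_of_isCompactOperator {H : Type*} [NormedAddCommGroup H]
    [InnerProductSpace ℂ H] [CompleteSpace H] {K : H →L[ℂ] H} (hK : IsCompactOperator K)
    {v : ℕ → H} {C : ℝ} (hC : ∀ k, ‖v k‖ ≤ C)
    (hweak : ∀ w : H, Tendsto (fun k => inner ℂ w (v k)) atTop (𝓝 0)) :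
    Tendsto (fun k => K (v k)) atTop (𝓝 0) := by
  obtain ⟨S, hS, hsub⟩ := hK.image_closedBall_subset_compact (f := (K : H →ₗ[ℂ] H)) C
  have hmem : ∀ k, K (v k) ∈ S := fun k =>
    hsub ⟨v k, by simpa using hC k, rfl⟩
  -- Every subsequence has a norm-convergent further subsequence by compactness; its limit `w` is
  -- also the weak limit, so `⟨w, w⟩ = 0`.
  refine tendsto_of_subseq_tendsto fun ns hns => ?_
  obtain ⟨w, -, θ, hθ, hlim⟩ := hS.tendsto_subseq fun k => hmem (ns k)
  refine ⟨θ, ?_⟩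
  have h1 : Tendsto (fun k => inner ℂ w (K (v (ns (θ k))))) atTop (𝓝 (inner ℂ w w)) :=
    tendsto_const_nhds.inner hlim
  have h2 : Tendsto (fun k => inner ℂ w (K (v (ns (θ k))))) atTop (𝓝 0) := by
    simp_rw [← ContinuousLinearMap.adjoint_inner_left]
    exact (hweak _).comp (hns.comp hθ.tendsto_atTop)
  have hw : w = 0 := inner_self_eq_zero.1 (tendsto_nhds_unique h1 h2)
  rw [← hw]
  exact hlim

section Manifold

variable {n : ℕ} {M : Type*} [TopologicalSpace M]

/-- Since `ψ = 1` wherever `f ≠ 0`, the cutoff disappears. The modulus is then independent of `ζ`,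
so normalizing `f` normalizes all the waves at once. -/
theorem pullbackFun_planeWave {κ : OpenPartialHomeomorph M (Eucl n)} (ψ : 𝓓(chartDomain κ, ℂ))
    {f : Eucl n → ℂ} (hf : HasCompactSupport f) (hfs : ContDiff ℝ ∞ f)
    (hψ : ∀ y, f y ≠ 0 → ψ y = 1) (ζ : Eucl n) (z : M) :
    pullbackFun κ ψ (planeWave hf hfs ζ) z =
      Complex.exp (Complex.I * (inner ℝ (κ z) ζ : ℝ)) * κ.source.indicator (f ∘ κ) z := by
  by_cases hz : z ∈ κ.source
  · rw [pullbackFun, if_pos hz, indicator_of_mem hz, planeWave_apply, Function.comp_apply]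
    by_cases h0 : f (κ z) = 0
    · simp [h0]
    · rw [hψ _ h0, one_mul]
  · rw [pullbackFun, if_neg hz, indicator_of_notMem hz, mul_zero]

variable [ChartedSpace (Eucl n) M] [IsManifold (𝓡 n) ∞ M] [MeasurableSpace M] [BorelSpace M]
  (g : Bundle.ContMDiffRiemannianMetric (𝓡 n) ∞ (Eucl n) (TangentSpace (𝓡 n) (M := M)))

/-- The ball has finite volume, as the density is bounded on its closure, and positive volume, as
the density is positive. Hence a bump has finite nonzero norm and can be rescaled. -/
theorem exists_normalized_bump {κ : OpenPartialHomeomorph M (Eucl n)}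
    (hκ : κ ∈ IsManifold.maximalAtlas (𝓡 n) ∞ M) {y₀ : Eucl n} {r : ℝ} (hr : 0 < r)
    (hrt : Metric.closedBall y₀ r ⊆ κ.target) :
    ∃ f : Eucl n → ℂ, HasCompactSupport f ∧ ContDiff ℝ ∞ f ∧
      (∀ y, f y ≠ 0 → y ∈ Metric.ball y₀ r) ∧
      eLpNorm (κ.source.indicator (f ∘ κ)) 2 (riemannianVolume g) = 1 := by
  let h : ContDiffBump y₀ := ⟨r / 2, r, by positivity, by linarith⟩
  set U : Set M := κ.source ∩ κ ⁻¹' Metric.ball y₀ r with hU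
  have hUm : MeasurableSet U := (κ.isOpen_inter_preimage Metric.isOpen_ball).measurableSet
  have hUtop : riemannianVolume g U < ⊤ := riemannianVolume_preimage_ball_lt_top g hκ hrt
  have hUpos : 0 < riemannianVolume g U :=
    riemannianVolume_preimage_pos g hκ Metric.isOpen_ball
      (Metric.ball_subset_closedBall.trans hrt) ⟨y₀, Metric.mem_ball_self hr⟩
  let F : M → ℂ := κ.source.indicator ((fun y => ((h y : ℝ) : ℂ)) ∘ κ)
  have hFU : ∀ z, F z ≠ 0 ↔ z ∈ U := by
    intro z
    by_cases hz : z ∈ κ.source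
    · have : h (κ z) ≠ 0 ↔ κ z ∈ Metric.ball y₀ r := by
        rw [← Function.mem_support, h.support_eq]
      simp [F, hz, hU, this]
    · simp [F, hz, hU]
  have hle : eLpNorm F 2 (riemannianVolume g) ≤
      eLpNorm (U.indicator fun _ => (1 : ℝ)) 2 (riemannianVolume g) := by
    refine eLpNorm_mono fun z => ?_
    by_cases hz : z ∈ U
    · rw [indicator_of_mem hz]
      simp only [F, indicator_of_mem hz.1, Function.comp_apply, Complex.norm_real]
      rw [Real.norm_of_nonneg h.nonneg, norm_one]
      exact h.le_one
    · have : F z = 0 := by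
        by_contra h0
        exact hz ((hFU z).1 h0)
      simp [this]
  have htop : eLpNorm F 2 (riemannianVolume g) ≠ ⊤ := by
    refine (hle.trans_lt ?_).ne
    exact (memLp_indicator_const 2 hUm 1 (Or.inr hUtop.ne)).2
  have hne : eLpNorm F 2 (riemannianVolume g) ≠ 0 := by
    intro h0
    have hsmall : eLpNorm (U.indicator F) 2 (riemannianVolume g) = 0 :=
      le_antisymm ((eLpNorm_indicator_le F).trans h0.le) bot_le
    rw [eLpNorm_indicator_eq_eLpNorm_restrict hUm] at hsmall
    have hFm : AEStronglyMeasurable F ((riemannianVolume g).restrict U) := by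
      have hc : ContinuousOn F U := by
        have : ContinuousOn ((fun y => ((h y : ℝ) : ℂ)) ∘ κ) U :=
          (Complex.continuous_ofReal.comp h.continuous).comp_continuousOn
            (κ.continuousOn.mono inter_subset_left)
        exact this.congr fun z hz => indicator_of_mem hz.1 _
      exact hc.aestronglyMeasurable hUm
    rw [eLpNorm_eq_zero_iff hFm (by simp)] at hsmall
    have hfalse : ∀ᵐ z ∂(riemannianVolume g).restrict U, False := by
      filter_upwards [hsmall, ae_restrict_mem hUm] with z hz hzU
      exact (hFU z).2 hzU hz
    rw [eventually_false_iff_eq_bot, ae_eq_bot, Measure.restrict_eq_zero] at hfalse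
    exact hUpos.ne' hfalse
  let β : ℝ := (eLpNorm F 2 (riemannianVolume g)).toReal⁻¹
  have hsupp : HasCompactSupport fun y => ((h y : ℝ) : ℂ) :=
    h.hasCompactSupport.comp_left Complex.ofReal_zero
  refine ⟨fun y => (β : ℂ) * ((h y : ℝ) : ℂ), hsupp.mul_left,
    contDiff_const.mul (Complex.ofRealCLM.contDiff.comp h.contDiff), fun y hy => ?_, ?_⟩
  · have h1 : y ∈ Function.support h := by
      intro h0
      simp [h0] at hy
    rwa [h.support_eq] at h1
  · have heq : κ.source.indicator ((fun y => (β : ℂ) * ((h y : ℝ) : ℂ)) ∘ κ) = (β : ℂ) • F := by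
      ext z
      by_cases hz : z ∈ κ.source <;> simp [F, hz]
    rw [heq, eLpNorm_const_smul]
    have hb : ‖(β : ℂ)‖ₑ = (eLpNorm F 2 (riemannianVolume g))⁻¹ := by
      rw [← ofReal_norm, Complex.norm_real, Real.norm_of_nonneg (by positivity),
        ENNReal.ofReal_inv_of_pos (ENNReal.toReal_pos hne htop), ENNReal.ofReal_toReal htop]
    rw [hb, ENNReal.inv_mul_cancel hne htop]

theorem integral_riemannianVolume_of_support_subset {κ : OpenPartialHomeomorph M (Eucl n)}
    (hκ : κ ∈ IsManifold.maximalAtlas (𝓡 n) ∞ M) {G : M → ℂ}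
    (hG : AEStronglyMeasurable G (riemannianVolume g)) (hsupp : ∀ z ∉ κ.source, G z = 0) :
    ∫ z, G z ∂(riemannianVolume g) =
      ∫ y in κ.target, (volumeDensity g κ y : ℂ) * G (κ.symm y) := by
  rw [← setIntegral_eq_integral_of_forall_compl_eq_zero hsupp,
    riemannianVolume_restrict_source g hκ, chartVolume_eq_map,
    integral_map (aemeasurable_symm g κ),
    integral_withDensity_eq_integral_toReal_smul₀]
  · refine setIntegral_congr_fun κ.open_target.measurableSet fun y hy => ?_
    rw [ENNReal.toReal_ofReal (volumeDensity_pos g hκ hy).le, Complex.real_smul]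
  · exact ((continuousOn_volumeDensity g hκ).aemeasurable
      κ.open_target.measurableSet).ennreal_ofReal
  · exact Eventually.of_forall fun _ => ENNReal.ofReal_lt_top
  · rw [← chartVolume_eq_map, ← riemannianVolume_restrict_source g hκ]
    exact hG.restrict

/-- Plane waves transported to the manifold converge weakly to zero. -/
theorem tendsto_inner_pullback_planeWave {κ : OpenPartialHomeomorph M (Eucl n)}
    (hκ : κ ∈ IsManifold.maximalAtlas (𝓡 n) ∞ M) (ψ : 𝓓(chartDomain κ, ℂ))
    {f : Eucl n → ℂ} (hf : HasCompactSupport f) (hfs : ContDiff ℝ ∞ f)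
    (hψ : ∀ y, f y ≠ 0 → ψ y = 1) {η : Eucl n} (hη : η ≠ 0)
    (hmem : ∀ ζ, MemLp (pullbackFun κ ψ (planeWave hf hfs ζ)) 2 (riemannianVolume g))
    (w : Lp ℂ 2 (riemannianVolume g)) :
    Tendsto (fun t : ℝ => inner ℂ w (hmem (t • η)).toLp) atTop (𝓝 0) := by
  let G : Eucl n → ℂ := κ.target.indicator fun y =>
    (volumeDensity g κ y : ℂ) * f y * (starRingEnd ℂ) (w (κ.symm y))
  -- Integrability of `G` need not be checked: otherwise the integrals all take the default value
  -- `0`.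
  have hRL := tendsto_integral_exp_inner_smul_cocompact G
  -- The character in the Riemann–Lebesgue lemma is `e^{-2πi y·w}`, so the frequency `w = -tη / 2π`
  -- gives `e^{it y·η}`.
  have hco : Tendsto (fun t : ℝ => (t * (-(2 * Real.pi)⁻¹)) • η) atTop (cocompact (Eucl n)) := by
    rw [← Metric.cobounded_eq_cocompact, ← tendsto_norm_atTop_iff_cobounded]
    have h1 : Tendsto (fun t : ℝ => t * ((2 * Real.pi)⁻¹ * ‖η‖)) atTop atTop :=
      tendsto_id.atTop_mul_const (mul_pos (by positivity) (norm_pos_iff.2 hη))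
    refine h1.congr' ?_
    filter_upwards [eventually_ge_atTop 0] with t ht
    rw [norm_smul, norm_mul, norm_neg, Real.norm_of_nonneg ht,
      Real.norm_of_nonneg (by positivity), mul_assoc]
  refine (hRL.comp hco).congr fun t => ?_
  have h1 : inner ℂ w (hmem (t • η)).toLp = ∫ z, pullbackFun κ ψ (planeWave hf hfs (t • η)) z *
      (starRingEnd ℂ) (w z) ∂(riemannianVolume g) := by
    rw [L2.inner_def]
    refine integral_congr_ae ?_
    filter_upwards [(hmem (t • η)).coeFn_toLp] with z hz
    rw [hz, RCLike.inner_apply]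
  rw [h1, integral_riemannianVolume_of_support_subset g hκ
    (G := fun z => pullbackFun κ ψ (planeWave hf hfs (t • η)) z * (starRingEnd ℂ) (w z))
    ((hmem _).1.mul (Complex.continuous_conj.comp_aestronglyMeasurable (Lp.aestronglyMeasurable w)))
    (fun z hz => by simp [pullbackFun, hz]),
    ← integral_indicator κ.open_target.measurableSet]
  refine integral_congr_ae (Eventually.of_forall fun y => ?_)
  by_cases hy : y ∈ κ.target
  · simp only [G, indicator_of_mem hy, pullbackFun_planeWave ψ hf hfs hψ,
      indicator_of_mem (κ.map_target hy), Function.comp_apply, κ.right_inv hy]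
    rw [Circle.smul_def, Real.fourierChar_apply, smul_eq_mul]
    have : ((2 * Real.pi * -inner ℝ y ((t * (-(2 * Real.pi)⁻¹)) • η) : ℝ) : ℂ) * Complex.I =
        Complex.I * ((inner ℝ y (t • η) : ℝ) : ℂ) := by
      rw [real_inner_smul_right, real_inner_smul_right]
      push_cast
      have : (Real.pi : ℂ) ≠ 0 := by simp [Real.pi_ne_zero]
      field_simp
    rw [this]
    ring
  · simp [G, hy]

/-- Every value of the principal symbol is bounded by the distance to a compact operator. -/
theorem IsPrincipalSymbolAt.enorm_le_l2NormSub [T2Space M]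
    {A : SmoothFun n M →ₗ[ℂ] SmoothFun n M} {x : M}
    {ξ : TangentSpace (𝓡 n) x →L[ℝ] ℝ} {s : ℂ} (hs : IsPrincipalSymbolAt 0 A x ξ s) (hξ : ξ ≠ 0)
    {K : Lp ℂ 2 (riemannianVolume g) →L[ℂ] Lp ℂ 2 (riemannianVolume g)}
    (hK : IsCompactOperator K) : ‖s‖ₑ ≤ l2NormSub (riemannianVolume g) A K := by
  obtain ⟨κ, hκ, φ, ψ, a, b, hx, hφ, hψ, hab, hloc, rfl⟩ := hs
  set η := coordCovector κ x ξ
  have hη : η ≠ 0 := coordCovector_ne_zero hκ hx hξ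
  refine ENNReal.le_of_forall_nnreal_lt fun c hc => ?_
  have hc' : (c : ℝ) < ‖b 0 (κ x) η‖ := by
    rw [← ofReal_norm, ← ENNReal.ofReal_coe_nnreal] at hc
    exact (ENNReal.ofReal_lt_ofReal_iff_of_nonneg c.2).1 hc
  have hcont : ContinuousAt (fun y => b 0 y η) (κ x) := by
    have hopen : IsOpen {p : Eucl n × Eucl n | p.2 ≠ 0} :=
      isOpen_ne_fun continuous_snd continuous_const
    have h1 : ContinuousAt (fun p : Eucl n × Eucl n => b 0 p.1 p.2) (κ x, η) :=
      (hab.smooth 0).continuousOn.continuousAt (hopen.mem_nhds hη)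
    exact h1.comp (f := fun y => (y, η)) (by fun_prop)
  -- On a small ball both cutoffs equal `1` and `|b₀(·, η)|` still exceeds `c`; the bump is placed
  -- there.
  have hnhds : ∀ᶠ y in 𝓝 (κ x), y ∈ κ.target ∧ φ y = 1 ∧ ψ y = 1 ∧ (c : ℝ) < ‖b 0 y η‖ := by
    filter_upwards [κ.open_target.mem_nhds (κ.map_source hx), hφ, hψ,
      hcont.norm.eventually (lt_mem_nhds hc')] with y h1 h2 h3 h4
    exact ⟨h1, h2, h3, h4⟩
  obtain ⟨r, hr, hball⟩ := Metric.nhds_basis_closedBall.eventually_iff.1 hnhds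
  obtain ⟨f, hf, hfs, hfB, hnorm⟩ := exists_normalized_bump g hκ hr fun y hy => (hball hy).1
  have hψ1 : ∀ y, f y ≠ 0 → ψ y = 1 := fun y hy =>
    (hball (Metric.ball_subset_closedBall (hfB y hy))).2.2.1
  set F : M → ℂ := κ.source.indicator (f ∘ κ) with hF
  set U : Set M := κ.source ∩ κ ⁻¹' Metric.ball (κ x) r
  have hUm : MeasurableSet U := (κ.isOpen_inter_preimage Metric.isOpen_ball).measurableSet
  have hnormv : ∀ ζ, eLpNorm (pullbackFun κ ψ (planeWave hf hfs ζ)) 2 (riemannianVolume g) = 1 := by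
    intro ζ
    rw [← hnorm]
    refine eLpNorm_congr_norm_ae (Eventually.of_forall fun z => ?_)
    rw [pullbackFun_planeWave ψ hf hfs hψ1, norm_mul, norm_exp_I_mul_ofReal, one_mul]
  have hmem : ∀ ζ, MemLp (pullbackFun κ ψ (planeWave hf hfs ζ)) 2 (riemannianVolume g) := fun ζ =>
    ⟨(contMDiff_pullbackFun hκ ψ _).continuous.aestronglyMeasurable, by simp [hnormv]⟩
  let v : ℕ → SmoothFun n M := fun k => pullback hκ ψ (planeWave hf hfs ((k : ℝ) • η))
  let V : ℕ → Lp ℂ 2 (riemannianVolume g) := fun k => (hmem ((k : ℝ) • η)).toLp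
  have hKV : Tendsto (fun k => ‖K (V k)‖ₑ) atTop (𝓝 0) := by
    have hVle : ∀ k, ‖V k‖ ≤ 1 := fun k => by
      simp [V, Lp.norm_toLp, hnormv]
    have := tendsto_apply_zero_of_isCompactOperator hK hVle fun w =>
      (tendsto_inner_pullback_planeWave g hκ ψ hf hfs hψ1 hη hmem w).comp
        tendsto_natCast_atTop_atTop
    simpa using this.enorm
  have hAc : ∀ k, AEStronglyMeasurable (A (v k) : M → ℂ) (riemannianVolume g) := fun k =>
    (A (v k)).2.continuous.aestronglyMeasurable
  have hAle : ∀ k, eLpNorm (A (v k) : M → ℂ) 2 (riemannianVolume g) ≤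
      l2NormSub (riemannianVolume g) A K + ‖K (V k)‖ₑ := by
    intro k
    have hN : eLpNorm (fun z => (A (v k) : M → ℂ) z - K (V k) z) 2 (riemannianVolume g) ≤
        l2NormSub (riemannianVolume g) A K :=
      le_iSup_of_le (v k) (le_iSup₂_of_le (hmem _) (hnormv _).le le_rfl)
    have hsum : (A (v k) : M → ℂ) =
        (fun z => (A (v k) : M → ℂ) z - K (V k) z) + (K (V k) : M → ℂ) := by
      ext z
      simp
    calc eLpNorm (A (v k) : M → ℂ) 2 (riemannianVolume g)
        ≤ eLpNorm (fun z => (A (v k) : M → ℂ) z - K (V k) z) 2 (riemannianVolume g) +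
            eLpNorm (K (V k)) 2 (riemannianVolume g) := by
          conv_lhs => rw [hsum]
          exact eLpNorm_add_le ((hAc k).sub (Lp.aestronglyMeasurable _))
            (Lp.aestronglyMeasurable _) (by norm_num)
      _ ≤ _ := by
          rw [Lp.enorm_def]
          gcongr
  -- On `U` the cutoff `φ` is `1`, so the local symbol determines `A (v k)`; elsewhere its values
  -- are discarded, which only lowers the norm.
  let G : M → ℝ := U.indicator fun z => ‖b 0 (κ z) η * f (κ z)‖
  have hlim : ∀ z, Tendsto (fun k => U.indicator (fun z => ‖(A (v k) : M → ℂ) z‖) z) atTop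
      (𝓝 (G z)) := by
    intro z
    by_cases hz : z ∈ U
    · simp only [G, indicator_of_mem hz]
      refine ((tendsto_norm_quantize_planeWave hab hf hfs hη (κ z)).comp
        tendsto_natCast_atTop_atTop).congr fun k => ?_
      have h1 := hloc (planeWave hf hfs ((k : ℝ) • η)) (κ z)
      rw [(hball (Metric.ball_subset_closedBall hz.2)).2.1, one_mul, κ.left_inv hz.1] at h1
      rw [Function.comp_apply, ← h1]
    · simp [G, hz]
  calc (c : ENNReal) = eLpNorm ((c : ℝ) • F) 2 (riemannianVolume g) := by
        rw [eLpNorm_const_smul, hnorm, mul_one]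
        simp
    _ ≤ eLpNorm G 2 (riemannianVolume g) := by
        refine eLpNorm_mono fun z => ?_
        by_cases hz : z ∈ U
        · simp only [G, indicator_of_mem hz, Pi.smul_apply, hF, indicator_of_mem hz.1, norm_smul,
            Function.comp_apply, norm_norm, norm_mul]
          gcongr
          simpa using (hball (Metric.ball_subset_closedBall hz.2)).2.2.2.le
        · have h0 : F z = 0 := by
            by_cases hzs : z ∈ κ.source
            · rw [hF, indicator_of_mem hzs, Function.comp_apply]
              by_contra h
              exact hz ⟨hzs, hfB _ h⟩
            · rw [hF, indicator_of_notMem hzs]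
          simp [h0]
    -- Fatou's lemma: pointwise convergence suffices for this lower bound.
    _ ≤ atTop.liminf fun k =>
        eLpNorm (U.indicator fun z => ‖(A (v k) : M → ℂ) z‖) 2 (riemannianVolume g) :=
        Lp.eLpNorm_lim_le_liminf_eLpNorm (fun k => (hAc k).norm.indicator hUm) G
          (Eventually.of_forall hlim)
    _ ≤ atTop.liminf fun k => l2NormSub (riemannianVolume g) A K + ‖K (V k)‖ₑ := by
        refine liminf_le_liminf (Eventually.of_forall fun k => ?_)
        refine (eLpNorm_indicator_le _).trans ?_
        rw [eLpNorm_norm]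
        exact hAle k
    _ = l2NormSub (riemannianVolume g) A K := by
        have := (tendsto_const_nhds (x := l2NormSub (riemannianVolume g) A K)).add hKV
        rw [add_zero] at this
        exact this.liminf_eq

end Manifold

end Gohberg

theorem lemmaA1 {n : ℕ} {M : Type*} [TopologicalSpace M] [T2Space M] [CompactSpace M]
    [ChartedSpace (Gohberg.Eucl n) M] [IsManifold (𝓡 n) ∞ M]
    [MeasurableSpace M] [BorelSpace M]
    (g : Bundle.ContMDiffRiemannianMetric (𝓡 n) ∞ (Gohberg.Eucl n)
      (TangentSpace (𝓡 n) (M := M)))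
    (A : Gohberg.SmoothFun n M →ₗ[ℂ] Gohberg.SmoothFun n M)
    (hA : Gohberg.IsClassicalPDO 0 A) :
    (⨆ (x : M) (ξ : TangentSpace (𝓡 n) x →L[ℝ] ℝ) (_ : ξ ≠ 0), ‖hA.principalSymbol x ξ‖ₑ)
      ≤ Gohberg.essNorm (Gohberg.riemannianVolume g) A := by
  refine iSup_le fun x => iSup₂_le fun ξ hξ => le_iInf₂ fun K hK => ?_
  -- The estimate holds for every admissible value of the symbol, in particular for the chosen one.
  exact (hA.exists_isPrincipalSymbolAt x ξ).choose_spec.enorm_le_l2NormSub g hξ hK
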